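/- Let $\Omega:=\{(\alpha,\beta)\in\mathbb{R}^2:\alpha>0,\ \beta>\tfrac12,\ \alpha+\beta<1\}$. For an integer $j\ge 0$ put $$e_j(\alpha):=1-\left(\frac{\alpha^j-\alpha^{j+1}}{1+\alpha^j-\alpha^{j+1}}\right)^{\frac1{j+1}},$$ and let $\Delta$ be the set of all $(\alpha,\beta)\in\Omega$ such that $\beta<e_j(\alpha)$ for all $j\ge 0$. Write $[n]=\{1,\dots,n\}$ and let $\binom{[n]}{k}$ be the set of all $k$-element subsets of $[n]$. Families $\mathcal A\subset\binom{[n]}{k}$ and $\mathcal B\subset\binom{[n]}{l}$ are called cross-intersecting if $A\cap B\neq\emptyset$ for all $A\in\mathcal A$, $B\in\mathcal B$. Let $M(n,k,l)$ be the maximum of $|\mathcal A||\mathcal B|$ over all cross-intersecting families $\mathcal A\subset\binom{[n]}{k}$, $\mathcal B\subset\binom{[n]}{l}$. Let $(\alpha,\beta)\in\Delta$ be fixed. Then there exists $n_0=n_0(\alpha,\beta)$ such that for every $n>n_0$, with $k=\lfloor\alpha n\rfloor$ and $l=\lfloor\beta n\rfloor$, $$M(n,k,l)=\binom{n-1}{k-1}\binom{n-1}{l-1}.$$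 Moreover, if $n>n_0$ and $\mathcal A\subset\binom{[n]}{k}$, $\mathcal B\subset\binom{[n]}{l}$ are cross-intersecting families satisfying $|\mathcal A||\mathcal B|=\binom{n-1}{k-1}\binom{n-1}{l-1}$, then there is $i\in[n]$ such that $\mathcal A=\{A\in\binom{[n]}{k}:i\in A\}$ and $\mathcal B=\{B\in\binom{[n]}{l}:i\in B\}$. -/

import Mathlib

namespace CrossIntersecting

/-- The triangle `Ω` of pairs `(α, β)` with `α > 0`, `β > 1/2` and `α + β < 1`. -/
def Omega : Set (ℝ × ℝ) :=
  {p | 0 < p.1 ∧ 1 / 2 < p.2 ∧ p.1 + p.2 < 1}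

/-- `e_j(α) = 1 - ((α^j - α^(j+1)) / (1 + α^j - α^(j+1)))^(1/(j+1))`. -/
noncomputable def e (j : ℕ) (α : ℝ) : ℝ :=
  1 - ((α ^ j - α ^ (j + 1)) / (1 + α ^ j - α ^ (j + 1))) ^ ((1 : ℝ) / ((j : ℝ) + 1))

/-- The region `Δ` of all `(α, β) ∈ Ω` with `β < e_j(α)` for every `j ≥ 0`. -/
def Delta : Set (ℝ × ℝ) :=
  {p | p ∈ Omega ∧ ∀ j : ℕ, p.2 < e j p.1}

/-- `A` is a family of `k`-element subsets of an `n`-element set, `B` is a family of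
`l`-element subsets, and every member of `A` meets every member of `B`. -/
def IsCrossPair (n k l : ℕ) (A B : Finset (Finset (Fin n))) : Prop :=
  (∀ a ∈ A, a.card = k) ∧ (∀ b ∈ B, b.card = l) ∧ ∀ a ∈ A, ∀ b ∈ B, (a ∩ b).Nonempty

/-- The set of all products `|A| * |B|` over cross-intersecting families `A`, `B` of
`k`-subsets and `l`-subsets of an `n`-element set. -/
def crossProducts (n k l : ℕ) : Set ℕ :=
  {m | ∃ A B : Finset (Finset (Fin n)), IsCrossPair n k l A B ∧ m = A.card * B.card}

/-- The star centred at `i`: all `k`-element subsets containing `i`. -/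
def star (n k : ℕ) (i : Fin n) : Finset (Finset (Fin n)) :=
  {a ∈ Finset.powersetCard k (Finset.univ : Finset (Fin n)) | i ∈ a}

end CrossIntersecting

namespace CrossIntersecting

open Finset
open scoped FinsetFamily

/-! By Kruskal–Katona, a cross-intersecting pair may be replaced by one at least as large that comes
from a colex initial segment. In such a pair all members of one of the two families contain the last
point; removing it leaves a pair on one point fewer (`Feasible.split`). Iteration shows that the two
densities add up to at most 1, strictly less if both families are nonempty and k + l < n
(`Feasible.chord`, `Feasible.chord_lt`).

If the first family is no larger than a star, one split and the chord bound suffice, because β > 1/2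
gives C(n-1, l) ≤ C(n-1, l-1) (`Feasible.mul_le_of_left_le`).

If it is larger, the natural competitors are: all k-sets containing 1 or all of j + 1 further
points, against all l-sets containing 1 and meeting these points. Their limiting product is αβ (1 +
(1-α)α^j)(1 - (1-β)^(j+1)), and β < e_j(α) says exactly that this is less than αβ. That nothing else
does better is seen in the limit. Limits of density pairs form a set covered by its images under two
affine maps, one for each branch of the split. On such a set a product (x + a)(z + b) is, under mild
conditions, largest at an end (0, 1) or (1, 0) (`IsSelfSimilar.le_max`,
`IsSelfSimilar.right_le_max`). Hence a pair as good as stars can never take the second branch after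
a fixed number of first-branch steps (`IsSelfSimilar.mul_lt_one`). Limits cannot exclude families
only slightly larger than a star, but after m first-branch steps, with α^m small against (1-β)^m,
the chord bound excludes any positive excess.

Extremal pairs have the sizes of stars; averaging and the strict chord bound then show that they are
stars (`IsCrossPair.eq_star`). -/

/-! ### Links and deletions -/

/-- The members of `A` containing `v`, with `v` removed. -/
def link {n : ℕ} (v : Fin (n + 1)) (A : Finset (Finset (Fin (n + 1)))) :
    Finset (Finset (Fin n)) :=
  {a | insert v (a.map v.succAboveEmb) ∈ A}

/-- The members of `A` avoiding `v`. -/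
def deletion {n : ℕ} (v : Fin (n + 1)) (A : Finset (Finset (Fin (n + 1)))) :
    Finset (Finset (Fin n)) :=
  {a | a.map v.succAboveEmb ∈ A}

section Links

variable {n k l : ℕ} {v : Fin (n + 1)} {A B : Finset (Finset (Fin (n + 1)))}

@[simp] lemma mem_link {a : Finset (Fin n)} :
    a ∈ link v A ↔ insert v (a.map v.succAboveEmb) ∈ A := by simp [link]

@[simp] lemma mem_deletion {a : Finset (Fin n)} :
    a ∈ deletion v A ↔ a.map v.succAboveEmb ∈ A := by simp [deletion]

lemma notMem_map_succAbove (v : Fin (n + 1)) (a : Finset (Fin n)) :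
    v ∉ a.map v.succAboveEmb := by
  simp [Fin.succAbove_ne]

lemma exists_map_succAbove_eq {s : Finset (Fin (n + 1))} (hs : v ∉ s) :
    ∃ a : Finset (Fin n), a.map v.succAboveEmb = s := by
  have h : s ⊆ (univ : Finset (Fin n)).map v.succAboveEmb := by
    intro x hx
    obtain ⟨y, hy⟩ := Fin.exists_succAbove_eq (x := x) (y := v) (by rintro rfl; exact hs hx)
    exact mem_map.2 ⟨y, mem_univ _, hy⟩
  obtain ⟨t, -, ht⟩ := subset_map_iff.1 h
  exact ⟨t, ht.symm⟩

lemma card_deletion (v : Fin (n + 1)) (A : Finset (Finset (Fin (n + 1)))) :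
    #(deletion v A) = #{a ∈ A | v ∉ a} := by
  refine card_bij (fun a _ => a.map v.succAboveEmb) ?_ ?_ ?_
  · intro a ha
    exact mem_filter.2 ⟨mem_deletion.1 ha, notMem_map_succAbove v a⟩
  · intro a _ b _ hab
    exact map_injective _ hab
  · intro s hs
    obtain ⟨hsA, hvs⟩ := mem_filter.1 hs
    obtain ⟨a, rfl⟩ := exists_map_succAbove_eq hvs
    exact ⟨a, mem_deletion.2 hsA, rfl⟩

lemma card_link (v : Fin (n + 1)) (A : Finset (Finset (Fin (n + 1)))) :
    #(link v A) = #{a ∈ A | v ∈ a} := by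
  refine card_bij (fun a _ => insert v (a.map v.succAboveEmb)) ?_ ?_ ?_
  · intro a ha
    exact mem_filter.2 ⟨mem_link.1 ha, mem_insert_self _ _⟩
  · intro a _ b _ hab
    apply map_injective v.succAboveEmb
    rw [← erase_insert (notMem_map_succAbove v a), ← erase_insert (notMem_map_succAbove v b)]
    exact congrArg (fun s => s.erase v) hab
  · intro s hs
    obtain ⟨hsA, hvs⟩ := mem_filter.1 hs
    obtain ⟨a, ha⟩ := exists_map_succAbove_eq (notMem_erase v s)
    have : insert v (a.map v.succAboveEmb) = s := by rw [ha, insert_erase hvs]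
    exact ⟨a, mem_link.2 (this ▸ hsA), this⟩

lemma card_link_add_card_deletion (v : Fin (n + 1)) (A : Finset (Finset (Fin (n + 1)))) :
    #(link v A) + #(deletion v A) = #A := by
  rw [card_link, card_deletion, card_filter_add_card_filter_not]

lemma IsCrossPair.symm {n k l : ℕ} {A B : Finset (Finset (Fin n))} (h : IsCrossPair n k l A B) :
    IsCrossPair n l k B A :=
  ⟨h.2.1, h.1, fun b hb a ha => by rw [inter_comm]; exact h.2.2 a ha b hb⟩

lemma IsCrossPair.link_deletion (h : IsCrossPair (n + 1) (k + 1) l A B) (v : Fin (n + 1)) :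
    IsCrossPair n k l (link v A) (deletion v B) := by
  refine ⟨fun a ha => ?_, fun b hb => ?_, fun a ha b hb => ?_⟩
  · have := h.1 _ (mem_link.1 ha)
    rw [card_insert_of_notMem (notMem_map_succAbove v a), card_map] at this
    omega
  · have := h.2.1 _ (mem_deletion.1 hb)
    rwa [card_map] at this
  · obtain ⟨x, hx⟩ := h.2.2 _ (mem_link.1 ha) _ (mem_deletion.1 hb)
    rw [insert_inter_of_notMem (notMem_map_succAbove v b), ← map_inter] at hx
    obtain ⟨y, hy, -⟩ := mem_map.1 hx
    exact ⟨y, hy⟩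

lemma IsCrossPair.deletion_link (h : IsCrossPair (n + 1) k (l + 1) A B) (v : Fin (n + 1)) :
    IsCrossPair n k l (deletion v A) (link v B) :=
  (h.symm.link_deletion v).symm

end Links

lemma IsCrossPair.card_left_le {n k l : ℕ} {A B : Finset (Finset (Fin n))}
    (h : IsCrossPair n k l A B) : #A ≤ n.choose k := by
  have : A ⊆ powersetCard k univ := fun a ha => mem_powersetCard_univ.2 (h.1 a ha)
  simpa using card_le_card this

lemma IsCrossPair.card_right_le {n k l : ℕ} {A B : Finset (Finset (Fin n))}
    (h : IsCrossPair n k l A B) : #B ≤ n.choose l :=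
  h.symm.card_left_le

/-! ### Feasible sizes and the colexicographic splitting -/

/-- There are cross-intersecting families of `k`-sets and `l`-sets with at least `u` and `v`
members respectively. -/
def Feasible (n k l u v : ℕ) : Prop :=
  ∃ A B : Finset (Finset (Fin n)), IsCrossPair n k l A B ∧ u ≤ #A ∧ v ≤ #B

lemma IsCrossPair.feasible {n k l : ℕ} {A B : Finset (Finset (Fin n))}
    (h : IsCrossPair n k l A B) : Feasible n k l #A #B :=
  ⟨A, B, h, le_rfl, le_rfl⟩

lemma Feasible.left_le {n k l u v : ℕ} (h : Feasible n k l u v) : u ≤ n.choose k := by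
  obtain ⟨A, B, hAB, hu, -⟩ := h
  exact hu.trans hAB.card_left_le

lemma Feasible.right_le {n k l u v : ℕ} (h : Feasible n k l u v) : v ≤ n.choose l := by
  obtain ⟨A, B, hAB, -, hv⟩ := h
  exact hv.trans hAB.card_right_le

lemma Feasible.symm {n k l u v : ℕ} (h : Feasible n k l u v) : Feasible n l k v u := by
  obtain ⟨A, B, hAB, hu, hv⟩ := h
  exact ⟨B, A, hAB.symm, hv, hu⟩

lemma exists_isInitSeg_card {α : Type*} [LinearOrder α] [Fintype α] (r m : ℕ)
    (hm : m ≤ (Fintype.card α).choose r) :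
    ∃ 𝒞 : Finset (Finset α), Colex.IsInitSeg 𝒞 r ∧ #𝒞 = m := by
  induction m with
  | zero => exact ⟨∅, Colex.isInitSeg_empty, rfl⟩
  | succ m ih =>
    obtain ⟨𝒞, h𝒞, hcard⟩ := ih (by omega)
    have hsub : 𝒞 ⊆ powersetCard r univ := fun c hc => mem_powersetCard_univ.2 (h𝒞.1 hc)
    have hne : (powersetCard r (univ : Finset α) \ 𝒞).Nonempty := by
      rw [← card_pos, card_sdiff_of_subset hsub, card_powersetCard, card_univ]
      omega
    -- The segment grows by the colex-least set it lacks.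
    obtain ⟨s, hs, hmin⟩ := exists_min_image _ (fun t => toColex t) hne
    obtain ⟨hsr, hs𝒞⟩ := mem_sdiff.1 hs
    refine ⟨insert s 𝒞, ⟨?_, ?_⟩, by rw [card_insert_of_notMem hs𝒞, hcard]⟩
    · intro t ht
      rcases mem_insert.1 (mem_coe.1 ht) with rfl | ht
      · exact mem_powersetCard_univ.1 hsr
      · exact h𝒞.1 ht
    · rintro t u ht ⟨hut, hu⟩
      rcases mem_insert.1 ht with rfl | ht
      · by_contra hcon
        have hu𝒞 : u ∉ 𝒞 := fun h => hcon (mem_insert_of_mem h)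
        exact absurd (hmin u (mem_sdiff.2 ⟨mem_powersetCard_univ.2 hu, hu𝒞⟩)) (not_le.2 hut)
      · exact mem_insert_of_mem (h𝒞.2 ht ⟨hut, hu⟩)

/-- Replacing the second family by the complements of a colex initial segment, one obtains a
cross-intersecting pair which is at least as large. -/
lemma IsCrossPair.exists_isInitSeg {n k l : ℕ} {A B : Finset (Finset (Fin n))}
    (h : IsCrossPair n k l A B) (hkl : k + l ≤ n) :
    ∃ 𝒞 : Finset (Finset (Fin n)), Colex.IsInitSeg 𝒞 (n - l) ∧ #𝒞 = #B ∧
      #A ≤ #(powersetCard k univ \ ∂^[n - l - k] 𝒞) ∧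
      IsCrossPair n k l (powersetCard k univ \ ∂^[n - l - k] 𝒞) 𝒞ᶜˢ := by
  have hsized : ((Bᶜˢ : Finset (Finset (Fin n))) : Set (Finset (Fin n))).Sized (n - l) := by
    intro s hs
    have := h.2.1 _ (mem_compls.1 (mem_coe.1 hs))
    rw [card_compl, Fintype.card_fin] at this
    have h2 := card_le_univ s
    rw [Fintype.card_fin] at h2
    omega
  obtain ⟨𝒞, h𝒞, hcard⟩ := exists_isInitSeg_card (α := Fin n) (n - l) #B (by
    rw [Fintype.card_fin, Nat.choose_symm (by omega)]
    exact h.card_right_le)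
  refine ⟨𝒞, h𝒞, hcard, ?_, fun a ha => ?_, fun b hb => ?_, fun a ha b hb => ?_⟩
  · have hkk : #(∂^[n - l - k] 𝒞) ≤ #(∂^[n - l - k] Bᶜˢ) :=
      iterated_kk hsized (by rw [hcard, card_compls]) h𝒞
    -- A member of `A` inside the complement of a member of `B` would miss that member.
    have hdisj : Disjoint A (∂^[n - l - k] Bᶜˢ) := by
      rw [disjoint_left]
      intro a ha hmem
      obtain ⟨s, hs, has, -⟩ := mem_shadow_iterate_iff_exists_sdiff.1 hmem
      obtain ⟨x, hx⟩ := h.2.2 a ha _ (mem_compls.1 hs)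
      have := mem_inter.1 hx
      exact (mem_compl.1 this.2) (has this.1)
    have hsub : A ∪ ∂^[n - l - k] Bᶜˢ ⊆ powersetCard k univ := by
      refine union_subset (fun a ha => mem_powersetCard_univ.2 (h.1 a ha)) fun s hs => ?_
      have := hsized.shadow_iterate (k := n - l - k) (mem_coe.2 hs)
      rw [mem_powersetCard_univ]
      omega
    have h1 := card_le_card hsub
    rw [card_union_of_disjoint hdisj] at h1
    have h2 := le_card_sdiff (∂^[n - l - k] 𝒞) (powersetCard k (univ : Finset (Fin n)))
    omega
  · exact mem_powersetCard_univ.1 (mem_sdiff.1 ha).1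
  · have := h𝒞.1 (mem_coe.2 (mem_compls.1 hb))
    rw [card_compl, Fintype.card_fin] at this
    have h2 := card_le_univ b
    rw [Fintype.card_fin] at h2
    omega
  · by_contra hne
    rw [not_nonempty_iff_eq_empty, ← disjoint_iff_inter_eq_empty] at hne
    obtain ⟨hak, has⟩ := mem_sdiff.1 ha
    have hsub : a ⊆ bᶜ := subset_compl_iff_disjoint_right.2 hne
    refine has (mem_shadow_iterate_iff_exists_sdiff.2 ⟨bᶜ, mem_compls.1 hb, hsub, ?_⟩)
    rw [card_sdiff_of_subset hsub, h𝒞.1 (mem_coe.2 (mem_compls.1 hb)),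
      mem_powersetCard_univ.1 hak]

/-- Feasible sizes split along the last element of the ground set. -/
theorem Feasible.split {n k l u v : ℕ} (h : Feasible (n + 1) (k + 1) (l + 1) u v)
    (hkl : k + l + 1 ≤ n) :
    Feasible n k (l + 1) u (v - n.choose l) ∨ Feasible n (k + 1) l (u - n.choose k) v := by
  obtain ⟨A, B, hAB, hu, hv⟩ := h
  obtain ⟨𝒞, h𝒞, hcard, hA, hcross⟩ := hAB.exists_isInitSeg (by omega)
  set A' := powersetCard (k + 1) univ \ ∂^[n + 1 - (l + 1) - (k + 1)] 𝒞 with hA'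
  have hBcard : #𝒞ᶜˢ = #B := by rw [card_compls, hcard]
  have sA := card_link_add_card_deletion (Fin.last n) A'
  have sB := card_link_add_card_deletion (Fin.last n) 𝒞ᶜˢ
  have c1 := hcross.link_deletion (Fin.last n)
  have c2 := hcross.deletion_link (Fin.last n)
  -- Sets avoiding the last point precede in colex all those containing it. So if some member of `𝒞`
  -- contains it, `𝒞` has every (n - l)-set avoiding it, and the shadow has every (k + 1)-set
  -- avoiding it. Otherwise all complements of members of `𝒞` contain it.
  by_cases hlast : ∃ c ∈ 𝒞, Fin.last n ∈ c
  · left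
    obtain ⟨c, hc, hlc⟩ := hlast
    have hdel : deletion (Fin.last n) A' = ∅ := by
      rw [eq_empty_iff_forall_notMem]
      intro a ha
      have ha' := mem_deletion.1 ha
      have hmem := mem_sdiff.1 ha'
      have hacard : #a = k + 1 := by
        have := mem_powersetCard_univ.1 hmem.1
        rwa [card_map] at this
      obtain ⟨t, hat, -, htcard⟩ := exists_subsuperset_card_eq (subset_univ a)
        (n := n - l) (by omega) (by rw [card_univ, Fintype.card_fin]; omega)
      have ht𝒞 : t.map (Fin.last n).succAboveEmb ∈ 𝒞 := by
        refine h𝒞.2 hc ⟨?_, by rw [card_map]; omega⟩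
        rw [Colex.toColex_lt_toColex_iff_exists_forall_lt]
        refine ⟨Fin.last n, hlc, notMem_map_succAbove _ _, fun b hb _ => ?_⟩
        exact lt_of_le_of_ne (Fin.le_last b)
          (by rintro rfl; exact notMem_map_succAbove _ _ hb)
      refine hmem.2 (mem_shadow_iterate_iff_exists_sdiff.2 ⟨_, ht𝒞, map_subset_map.2 hat, ?_⟩)
      rw [card_sdiff_of_subset (map_subset_map.2 hat), card_map, card_map]
      omega
    rw [hdel, card_empty] at sA
    have := c2.card_right_le
    exact ⟨_, _, c1, by omega, by omega⟩
  · right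
    push Not at hlast
    have hdel : deletion (Fin.last n) 𝒞ᶜˢ = ∅ := by
      rw [eq_empty_iff_forall_notMem]
      intro b hb
      have := hlast _ (mem_compls.1 (mem_deletion.1 hb))
      exact this (mem_compl.2 (notMem_map_succAbove _ _))
    rw [hdel, card_empty] at sB
    have := c1.card_left_le
    exact ⟨_, _, c2, by omega, by omega⟩

end CrossIntersecting

namespace CrossIntersecting

open Finset
open scoped FinsetFamily

/-! ### The linear bound -/

lemma choose_mul_choose_mul (n k l : ℕ) :
    n.choose (k + 1) * n.choose (l + 1) * ((k + 1) * (l + 1)) =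
      n.choose k * n.choose l * ((n - k) * (n - l)) := by
  have h1 := Nat.choose_succ_right_eq n k
  have h2 := Nat.choose_succ_right_eq n l
  calc _ = (n.choose (k + 1) * (k + 1)) * (n.choose (l + 1) * (l + 1)) := by ring
    _ = _ := by rw [h1, h2]; ring

lemma choose_mul_choose_le {n k l : ℕ} (h : k + l + 1 ≤ n) :
    n.choose k * n.choose l ≤ n.choose (k + 1) * n.choose (l + 1) := by
  have h1 := choose_mul_choose_mul n k l
  have h2 : (k + 1) * (l + 1) ≤ (n - k) * (n - l) := by
    rw [mul_comm (k + 1)]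
    exact Nat.mul_le_mul (by omega) (by omega)
  refine Nat.le_of_mul_le_mul_right (c := (k + 1) * (l + 1)) ?_ (by positivity)
  rw [h1]
  exact Nat.mul_le_mul_left _ h2

lemma choose_mul_choose_lt {n k l : ℕ} (h : k + l + 1 < n) :
    n.choose k * n.choose l < n.choose (k + 1) * n.choose (l + 1) := by
  have h1 := choose_mul_choose_mul n k l
  have h2 : (k + 1) * (l + 1) < (n - k) * (n - l) := by
    rw [mul_comm (k + 1)]
    exact Nat.mul_lt_mul'' (by omega) (by omega)
  refine Nat.lt_of_mul_lt_mul_right (a := (k + 1) * (l + 1)) ?_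
  rw [h1]
  exact Nat.mul_lt_mul_of_pos_left h2
    (Nat.mul_pos (Nat.choose_pos (by omega)) (Nat.choose_pos (by omega)))

/-- Geometrically, PQ ≤ P'Q' says that the point with coordinates P/(P+P') and Q/(Q+Q') lies on or
below the line a + b = 1. The chord from (0, 1) to that point then does too, and the branch maps its
own chord bound onto this chord. -/
lemma chord_step {P P' Q Q' u v v' : ℕ} (hP : 0 < P) (hPQ : P * Q ≤ P' * Q')
    (h : u * Q' + v' * P ≤ P * Q') (hv : v ≤ Q + v') :
    u * (Q + Q') + v * (P + P') ≤ (P + P') * (Q + Q') ∧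
      (P * Q < P' * Q' → 0 < u → u * (Q + Q') + v * (P + P') < (P + P') * (Q + Q')) := by
  have e1 : u * (P * Q) ≤ u * (P' * Q') := Nat.mul_le_mul_left _ hPQ
  have e2 : (u * Q' + v' * P) * (P + P') ≤ (P * Q') * (P + P') := Nat.mul_le_mul_right _ h
  have e3 : v * (P * (P + P')) ≤ (Q + v') * (P * (P + P')) := Nat.mul_le_mul_right _ hv
  constructor
  · refine Nat.le_of_mul_le_mul_left (c := P) ?_ hP
    nlinarith
  · intro hlt hu
    have e4 : u * (P * Q) < u * (P' * Q') := Nat.mul_lt_mul_of_pos_left hlt hu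
    refine Nat.lt_of_mul_lt_mul_left (a := P) ?_
    nlinarith

lemma Feasible.eq_zero_or_eq_zero {n l u v : ℕ} (h : Feasible n 0 l u v) : u = 0 ∨ v = 0 := by
  obtain ⟨A, B, hAB, hu, hv⟩ := h
  by_contra! hne
  obtain ⟨a, ha⟩ : A.Nonempty := card_pos.1 (by omega)
  obtain ⟨b, hb⟩ : B.Nonempty := card_pos.1 (by omega)
  have := hAB.2.2 a ha b hb
  rw [card_eq_zero.1 (hAB.1 a ha)] at this
  simp at this

/-- The densities of cross-intersecting families add up to at most `1`, and to less than `1` if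
both families are nonempty and `k + l < n`. -/
theorem Feasible.chord_aux {n k l u v : ℕ} (h : Feasible n k l u v) (hkl : k + l ≤ n) :
    u * n.choose l + v * n.choose k ≤ n.choose k * n.choose l ∧
      (k + l < n → 0 < u → 0 < v →
        u * n.choose l + v * n.choose k < n.choose k * n.choose l) := by
  have triv : ∀ {n k l u v : ℕ}, Feasible n k l u v → u = 0 ∨ v = 0 →
      u * n.choose l + v * n.choose k ≤ n.choose k * n.choose l ∧
      (k + l < n → 0 < u → 0 < v →
        u * n.choose l + v * n.choose k < n.choose k * n.choose l) := by
    intro n k l u v h h0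
    refine ⟨?_, by omega⟩
    rcases h0 with rfl | rfl
    · simpa [mul_comm] using Nat.mul_le_mul_right (n.choose k) h.right_le
    · simpa using Nat.mul_le_mul_right (n.choose l) h.left_le
  induction n generalizing k l u v with
  | zero =>
    obtain rfl : k = 0 := by omega
    exact triv h h.eq_zero_or_eq_zero
  | succ n ih =>
    rcases k with _ | k
    · exact triv h h.eq_zero_or_eq_zero
    rcases l with _ | l
    · exact triv h h.symm.eq_zero_or_eq_zero.symm
    rw [Nat.choose_succ_succ' n k, Nat.choose_succ_succ' n l]
    rcases h.split (by omega) with h1 | h1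
    · have := chord_step (Nat.choose_pos (by omega)) (choose_mul_choose_le (by omega))
        (ih h1 (by omega)).1 (v := v) (Q := n.choose l) (P' := n.choose (k + 1)) (by omega)
      exact ⟨this.1, fun hlt hu _ => this.2 (choose_mul_choose_lt (by omega)) hu⟩
    · have := chord_step (Nat.choose_pos (by omega))
        (choose_mul_choose_le (n := n) (k := l) (l := k) (by omega))
        (ih h1.symm (by omega)).1 (v := u) (by omega)
      refine ⟨by linarith [this.1], fun hlt _ hv => ?_⟩
      have := this.2 (choose_mul_choose_lt (by omega)) hv
      linarith

theorem Feasible.chord {n k l u v : ℕ} (h : Feasible n k l u v) (hkl : k + l ≤ n) :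
    u * n.choose l + v * n.choose k ≤ n.choose k * n.choose l :=
  (h.chord_aux hkl).1

theorem Feasible.chord_lt {n k l u v : ℕ} (h : Feasible n k l u v) (hkl : k + l < n)
    (hu : 0 < u) (hv : 0 < v) :
    u * n.choose l + v * n.choose k < n.choose k * n.choose l :=
  (h.chord_aux hkl.le).2 hkl hu hv

/-! ### First families no larger than a star -/

/-- With S and T the sizes of the two stars, the first branch and the chord bound give v ≤ T + (S -
u)T/S, as C(n, l+1) ≤ T. Hence uv ≤ T u(2S - u)/S, which is below ST for u < S. The second branch
gives v ≤ T directly. -/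
theorem Feasible.mul_le_of_left_le {n k l u v : ℕ} (h : Feasible (n + 1) (k + 1) (l + 1) u v)
    (hkl : k + l + 1 < n) (hl : n < 2 * l + 1) (hu : u ≤ n.choose k) :
    u * v ≤ n.choose k * n.choose l ∧
      (u * v = n.choose k * n.choose l → u = n.choose k ∧ v = n.choose l) := by
  have hS : 0 < n.choose k := Nat.choose_pos (by omega)
  have hT : 0 < n.choose l := Nat.choose_pos (by omega)
  have both : v ≤ n.choose l → u * v ≤ n.choose k * n.choose l ∧
      (u * v = n.choose k * n.choose l → u = n.choose k ∧ v = n.choose l) := by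
    intro hv
    refine ⟨Nat.mul_le_mul hu hv, fun heq => ⟨?_, ?_⟩⟩
    · by_contra hne
      have : u * v < n.choose k * n.choose l :=
        Nat.mul_lt_mul_of_lt_of_le (lt_of_le_of_ne hu hne) hv hT
      omega
    · by_contra hne
      have : u * v < n.choose k * n.choose l :=
        Nat.mul_lt_mul_of_le_of_lt hu (lt_of_le_of_ne hv hne) hS
      omega
  rcases h.split (by omega) with h1 | h1
  · rcases hu.eq_or_lt with hu' | hu'
    · apply both
      have := h1.chord (by omega)
      rw [hu'] at this
      have h0 : (v - n.choose l) * n.choose k = 0 := by omega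
      rcases Nat.mul_eq_zero.1 h0 with h0 | h0 <;> omega
    · suffices u * v < n.choose k * n.choose l from ⟨this.le, fun h => absurd h this.ne⟩
      have hch := h1.chord (by omega)
      have hT' : n.choose (l + 1) ≤ n.choose l := by
        have := Nat.choose_succ_right_eq n l
        refine Nat.le_of_mul_le_mul_right (c := l + 1) ?_ (by omega)
        rw [this]
        exact Nat.mul_le_mul_left _ (by omega)
      obtain ⟨d, hd⟩ := Nat.exists_eq_add_of_lt hu'
      have hv : v ≤ n.choose l + (v - n.choose l) := by omega
      generalize v - n.choose l = w at *
      generalize n.choose k = S at *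
      generalize n.choose l = T at *
      generalize n.choose (l + 1) = T' at *
      have e1 : w * S ≤ (d + 1) * T' := by
        have : S * T' = u * T' + (d + 1) * T' := by rw [hd]; ring
        omega
      have e2 : u * (w * S) ≤ u * ((d + 1) * T) :=
        Nat.mul_le_mul_left _ (e1.trans (Nat.mul_le_mul_left _ hT'))
      have e3 : u * ((d + 1) * T) < S * ((d + 1) * T) :=
        Nat.mul_lt_mul_of_pos_right hu' (by positivity)
      refine Nat.lt_of_mul_lt_mul_right (a := S) ?_
      calc u * v * S ≤ u * (T + w) * S := by gcongr
        _ = u * T * S + u * (w * S) := by ring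
        _ < u * T * S + S * ((d + 1) * T) := by omega
        _ = S * T * S := by
          subst hd; ring
  · exact both h1.right_le

/-! ### Stars -/

lemma card_star (n k : ℕ) (i : Fin (n + 1)) : #(star (n + 1) (k + 1) i) = n.choose k := by
  have h0 : deletion i (star (n + 1) (k + 1) i) = ∅ := by
    rw [eq_empty_iff_forall_notMem]
    intro a ha
    exact notMem_map_succAbove i a (mem_filter.1 (mem_deletion.1 ha)).2
  have h1 : link i (star (n + 1) (k + 1) i) = powersetCard k univ := by
    ext a
    rw [mem_link, mem_powersetCard_univ, star, mem_filter, mem_powersetCard_univ,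
      card_insert_of_notMem (notMem_map_succAbove i a), card_map]
    simp
  rw [← card_link_add_card_deletion i, h0, h1]
  simp

lemma isCrossPair_star (n k l : ℕ) (i : Fin n) :
    IsCrossPair n k l (star n k i) (star n l i) :=
  ⟨fun _ ha => mem_powersetCard_univ.1 (mem_filter.1 ha).1,
    fun _ hb => mem_powersetCard_univ.1 (mem_filter.1 hb).1,
    fun _ ha _ hb => ⟨i, mem_inter.2 ⟨(mem_filter.1 ha).2, (mem_filter.1 hb).2⟩⟩⟩

lemma eq_star_of_deletion_eq_empty {n k : ℕ} {A : Finset (Finset (Fin (n + 1)))}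
    {i : Fin (n + 1)} (hA : ∀ a ∈ A, #a = k + 1) (hcard : #A = n.choose k)
    (hdel : deletion i A = ∅) : A = star (n + 1) (k + 1) i := by
  refine eq_of_subset_of_card_le (fun a ha => ?_) (by rw [card_star, hcard])
  refine mem_filter.2 ⟨mem_powersetCard_univ.2 (hA a ha), ?_⟩
  by_contra hia
  obtain ⟨b, rfl⟩ := exists_map_succAbove_eq hia
  have : b ∈ deletion i A := mem_deletion.2 ha
  simp [hdel] at this

lemma exists_mul_card_le_card_link {n l : ℕ} {B : Finset (Finset (Fin (n + 1)))}
    (hB : ∀ b ∈ B, #b = l) : ∃ v : Fin (n + 1), l * #B ≤ (n + 1) * #(link v B) := by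
  by_contra! hlt
  have hsum : ∑ v : Fin (n + 1), #(link v B) = l * #B := by
    simp_rw [card_link, card_filter]
    rw [sum_comm]
    simp_rw [← card_filter]
    rw [sum_congr rfl (g := fun _ => l) fun b hb => by simpa using hB b hb]
    simp [mul_comm]
  have : ∑ v : Fin (n + 1), (n + 1) * #(link v B) < ∑ _v : Fin (n + 1), l * #B :=
    sum_lt_sum_of_nonempty univ_nonempty fun v _ => hlt v
  rw [← mul_sum, hsum] at this
  simp at this

/-- Cross-intersecting families with the sizes of stars are stars. -/
theorem IsCrossPair.eq_star {n k l : ℕ} {A B : Finset (Finset (Fin (n + 2)))}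
    (h : IsCrossPair (n + 2) (k + 2) (l + 2) A B) (hkl : k + l + 2 < n)
    (hA : #A = (n + 1).choose (k + 1)) (hB : #B = (n + 1).choose (l + 1)) :
    ∃ i, A = star (n + 2) (k + 2) i ∧ B = star (n + 2) (l + 2) i := by
  -- A point of at least average degree in `B` serves as the centre; its link is large enough to
  -- determine the branch of the next split.
  obtain ⟨i, hi⟩ := exists_mul_card_le_card_link h.2.1
  have sA := card_link_add_card_deletion i A
  have sB := card_link_add_card_deletion i B
  have hlarge : n.choose l < #(link i B) := by
    have h1 := Nat.add_one_mul_choose_eq n l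
    rw [hB] at hi
    by_contra! hle
    have h2 : (n + 2) * #(link i B) ≤ (n + 2) * n.choose l := Nat.mul_le_mul_left _ hle
    have h3 : n.choose l < (n + 1).choose (l + 1) := by
      rw [Nat.choose_succ_succ']
      have : 0 < n.choose (l + 1) := Nat.choose_pos (by omega)
      omega
    nlinarith
  rw [Nat.choose_succ_succ'] at hA hB
  have hS : 0 < n.choose (k + 1) := Nat.choose_pos (by omega)
  have hT : 0 < n.choose (l + 1) := Nat.choose_pos (by omega)
  obtain ⟨y, hy⟩ := Nat.exists_eq_add_of_lt hlarge
  have f1 : Feasible n (k + 1) (l + 1) #(deletion i A) (y + 1) := by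
    rcases (h.deletion_link i).feasible.split (by omega) with h1 | h1
    · convert h1 using 1
      omega
    · have := h1.right_le
      omega
  have c1 : (#(link i A) - n.choose k) * n.choose (l + 1) +
      #(deletion i B) * n.choose (k + 1) ≤ n.choose (k + 1) * n.choose (l + 1) := by
    rcases (h.link_deletion i).feasible.split (by omega) with h1 | h1
    · have h2 := h1.left_le
      rw [Nat.sub_eq_zero_of_le h2, zero_mul, zero_add, mul_comm]
      exact Nat.mul_le_mul_left _ (by omega)
    · exact h1.chord (by omega)
  have c0 := f1.chord (by omega)
  -- The sizes of `A` and `B` make the sum of the two chord bounds `c0` and `c1` an equality, so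
  -- both are tight. Since y + 1 > 0, strictness forces the deletion of `A` to be empty, and then
  -- that of `B`.
  have hp : n.choose (k + 1) ≤ #(deletion i A) + (#(link i A) - n.choose k) := by omega
  have hB0 : #(deletion i B) + (y + 1) = n.choose (l + 1) := by omega
  have hp' := Nat.mul_le_mul_right (n.choose (l + 1)) hp
  have hB0' := congrArg (· * n.choose (k + 1)) hB0
  simp only [add_mul] at hp' hB0' c0
  have hA0 : #(deletion i A) = 0 := by
    by_contra hne
    have := f1.chord_lt (by omega) (Nat.pos_of_ne_zero hne) (by omega)
    simp only [add_mul] at this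
    have hc := mul_comm (n.choose (k + 1)) (n.choose (l + 1))
    omega
  have hB1 : #(deletion i B) = 0 := by
    by_contra hne
    have := Nat.mul_pos (Nat.pos_of_ne_zero hne) hS
    rw [hA0] at hp' c0
    have hc := mul_comm (n.choose (k + 1)) (n.choose (l + 1))
    omega
  refine ⟨i, eq_star_of_deletion_eq_empty h.1 ?_ (card_eq_zero.1 hA0),
    eq_star_of_deletion_eq_empty h.2.1 ?_ (card_eq_zero.1 hB1)⟩
  · rw [hA, Nat.choose_succ_succ']
  · rw [hB, Nat.choose_succ_succ']

end CrossIntersecting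

namespace CrossIntersecting

/-! ### The limit problem -/

/-- A set of pairs of densities below the line `a + b = 1` which is covered by its images under the
two affine maps `(a, b) ↦ (α a, β + (1 - β) b)` and `(a, b) ↦ (α + (1 - α) a, β b)`. -/
structure IsSelfSimilar (α β : ℝ) (Γ : Set (ℝ × ℝ)) : Prop where
  nonneg_left : ∀ p ∈ Γ, 0 ≤ p.1
  nonneg_right : ∀ p ∈ Γ, 0 ≤ p.2
  add_le_one : ∀ p ∈ Γ, p.1 + p.2 ≤ 1
  cover : ∀ p ∈ Γ, ∃ p' ∈ Γ, (p.1 ≤ α * p'.1 ∧ p.2 ≤ β + (1 - β) * p'.2) ∨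
    (p.1 ≤ α + (1 - α) * p'.1 ∧ p.2 ≤ β * p'.2)

namespace IsSelfSimilar

variable {α β : ℝ} {Γ : Set (ℝ × ℝ)}

/-- The value of `(x + a) (z + b)` at the point `(α, β)` is at most its value at one of the points
`(0, 1)` and `(1, 0)`, provided `x` or `z` is large. -/
lemma middle_le_max (hα : 0 < α) (hβ : 0 < β) (hαβ : α + β < 1) {x z : ℝ}
    (h : α * β ≤ (1 - β - α) * x ∨ α * β ≤ (1 - β - α) * z) :
    (x + α) * (z + β) ≤ max (x * (z + 1)) ((x + 1) * z) := by
  rw [le_max_iff]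
  rcases le_total z x with hzx | hzx
  · left
    have : α * β ≤ (1 - β - α) * x := h.elim id fun h => h.trans (by gcongr; linarith)
    nlinarith
  · right
    have : α * β ≤ (1 - β - α) * z := h.elim (fun h => h.trans (by gcongr; linarith)) id
    nlinarith

/-- One step of the recursion: a bound for `(x + a) (z + b)` follows from bounds for the two
rescaled functions. -/
lemma step (hΓ : IsSelfSimilar α β Γ) (hα : 0 < α) (hα' : α < 1) (hβ : 0 < β) (hβ' : β < 1)
    {x z W : ℝ} (hx : 0 ≤ x) (hz : 0 ≤ z)
    (hL : ∀ p ∈ Γ, (x / α + p.1) * ((z + β) / (1 - β) + p.2) ≤ W / (α * (1 - β)))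
    (hR : ∀ p ∈ Γ, ((x + α) / (1 - α) + p.1) * (z / β + p.2) ≤ W / ((1 - α) * β)) :
    ∀ p ∈ Γ, (x + p.1) * (z + p.2) ≤ W := by
  intro p hp
  have h1 : 0 < 1 - α := by linarith
  have h2 : 0 < 1 - β := by linarith
  obtain ⟨p', hp', h | h⟩ := hΓ.cover p hp
  · have := hL p' hp'
    rw [le_div_iff₀ (by positivity)] at this
    calc (x + p.1) * (z + p.2) ≤ (x + α * p'.1) * (z + (β + (1 - β) * p'.2)) := by
          have := hΓ.nonneg_left p hp
          have := hΓ.nonneg_right p hp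
          gcongr <;> linarith
      _ = (x / α + p'.1) * ((z + β) / (1 - β) + p'.2) * (α * (1 - β)) := by
          field_simp
          ring
      _ ≤ W := this
  · have := hR p' hp'
    rw [le_div_iff₀ (by positivity)] at this
    calc (x + p.1) * (z + p.2) ≤ (x + (α + (1 - α) * p'.1)) * (z + β * p'.2) := by
          have := hΓ.nonneg_left p hp
          have := hΓ.nonneg_right p hp
          gcongr <;> linarith
      _ = ((x + α) / (1 - α) + p'.1) * (z / β + p'.2) * ((1 - α) * β) := by
          field_simp
          ring
      _ ≤ W := this

lemma max_left_eq (hα : 0 < α) (hβ : β < 1) (x z : ℝ) :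
    max (x / α * ((z + β) / (1 - β) + 1)) ((x / α + 1) * ((z + β) / (1 - β))) =
      max (x * (z + 1)) ((x + α) * (z + β)) / (α * (1 - β)) := by
  have h2 : 0 < 1 - β := by linarith
  rw [← max_div_div_right (by positivity)]
  congr 1 <;> field_simp
  ring

lemma max_right_eq (hα : α < 1) (hβ : 0 < β) (x z : ℝ) :
    max ((x + α) / (1 - α) * (z / β + 1)) (((x + α) / (1 - α) + 1) * (z / β)) =
      max ((x + α) * (z + β)) ((x + 1) * z) / ((1 - α) * β) := by
  have h2 : 0 < 1 - α := by linarith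
  rw [← max_div_div_right (by positivity)]
  congr 1 <;> field_simp
  ring

/-- Each branch turns the product into one of the same form with new x and z, neither of which
decreases, so the hypothesis persists and the value at (α, β) stays below the maximum over the ends.
The error factor starts from the trivial bound (x + 1)(z + 1) and shrinks because x grows by a
factor of at least 1/(1 - α); for the first branch this needs α ≤ 1/2. -/
lemma le_one_add_mul_max (hΓ : IsSelfSimilar α β Γ) (hα : 0 < α) (hα2 : α ≤ 1 / 2) (hβ : 0 < β)
    (hαβ : α + β < 1) (r : ℕ) {x z : ℝ} (hx : 0 < x) (hz : 0 ≤ z)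
    (h : α * β ≤ (1 - β - α) * x ∨ α * β ≤ (1 - β - α) * z) :
    ∀ p ∈ Γ, (x + p.1) * (z + p.2) ≤
      (1 + (1 - α) ^ r / x) * max (x * (z + 1)) ((x + 1) * z) := by
  have h1 : 0 < 1 - α := by linarith
  have h2 : 0 < 1 - β := by linarith
  have h3 : 0 < 1 - β - α := by linarith
  induction r generalizing x z with
  | zero =>
    intro p hp
    have a0 := hΓ.nonneg_left p hp
    have b0 := hΓ.nonneg_right p hp
    have ab := hΓ.add_le_one p hp
    calc (x + p.1) * (z + p.2) ≤ (x + 1) * (z + 1) := by gcongr <;> linarith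
      _ = (1 + (1 - α) ^ 0 / x) * (x * (z + 1)) := by field_simp
      _ ≤ _ := by gcongr; exact le_max_left _ _
  | succ r ih =>
    have hM := middle_le_max hα hβ hαβ h
    have hxL : x ≤ x / α := by
      rw [le_div_iff₀ hα]; nlinarith
    have hxL' : x / (1 - α) ≤ x / α := by gcongr; linarith
    have hxR : x / (1 - α) ≤ (x + α) / (1 - α) := by gcongr; linarith
    have hxx : x ≤ x / (1 - α) := by
      rw [le_div_iff₀ h1]; nlinarith
    have hzL : z ≤ (z + β) / (1 - β) := by
      rw [le_div_iff₀ h2]; nlinarith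
    have hzR : z ≤ z / β := by
      rw [le_div_iff₀ hβ]; nlinarith
    have key : ∀ {y : ℝ}, x / (1 - α) ≤ y →
        1 + (1 - α) ^ r / y ≤ 1 + (1 - α) ^ (r + 1) / x := by
      intro y hy
      have : (1 - α) ^ (r + 1) / x = (1 - α) ^ r / (x / (1 - α)) := by
        field_simp
        ring
      rw [this]
      gcongr
    refine hΓ.step hα (by linarith) hβ (by linarith) hx.le hz ?_ ?_
    · intro p hp
      refine (ih (x := x / α) (z := (z + β) / (1 - β)) (by positivity) (by positivity)
        (h.imp (fun h => h.trans (by gcongr)) fun h => h.trans (by gcongr)) p hp).trans ?_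
      rw [max_left_eq hα (by linarith), ← mul_div_assoc]
      exact div_le_div_of_nonneg_right (mul_le_mul (key hxL') (max_le (le_max_left _ _) hM)
        (le_max_of_le_left (by positivity)) (by positivity)) (by positivity)
    · intro p hp
      refine (ih (x := (x + α) / (1 - α)) (z := z / β) (by positivity) (by positivity)
        (h.imp (fun h => h.trans (by gcongr; linarith)) fun h => h.trans (by gcongr)) p hp).trans ?_
      rw [max_right_eq (by linarith) hβ, ← mul_div_assoc]
      exact div_le_div_of_nonneg_right (mul_le_mul (key hxR) (max_le hM (le_max_right _ _))
        (le_max_of_le_left (by positivity)) (by positivity)) (by positivity)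

theorem le_max (hΓ : IsSelfSimilar α β Γ) (hα : 0 < α) (hα2 : α ≤ 1 / 2) (hβ : 0 < β)
    (hαβ : α + β < 1) {x z : ℝ} (hx : 0 < x) (hz : 0 ≤ z)
    (h : α * β ≤ (1 - β - α) * x ∨ α * β ≤ (1 - β - α) * z) :
    ∀ p ∈ Γ, (x + p.1) * (z + p.2) ≤ max (x * (z + 1)) ((x + 1) * z) := by
  intro p hp
  have hlim : Filter.Tendsto (fun r : ℕ => (1 + (1 - α) ^ r / x) *
      max (x * (z + 1)) ((x + 1) * z)) Filter.atTop
      (nhds ((1 + 0 / x) * max (x * (z + 1)) ((x + 1) * z))) :=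
    ((((tendsto_pow_atTop_nhds_zero_of_lt_one (by linarith) (by linarith)).div_const x).const_add
      1).mul_const _)
  rw [zero_div, add_zero, one_mul] at hlim
  exact ge_of_tendsto' hlim fun r => hΓ.le_one_add_mul_max hα hα2 hβ hαβ r hx hz h p hp

/-- If `(x + a) (z + b)` at the middle point does not exceed its value at `(0, 1)`, then beyond the
middle point it is at most the larger of its values at `(α, β)` and at `(1, 0)`. -/
theorem right_le_max (hΓ : IsSelfSimilar α β Γ) (hα : 0 < α) (hβ : 1 / 2 < β)
    (hαβ : α + β < 1) (h0 : β * (2 - α) < 1) {x z : ℝ} (hx : 0 < x) (hz : 0 ≤ z)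
    (hM : α * (z + β) ≤ (1 - β) * x) :
    ∀ p ∈ Γ, (x + α + (1 - α) * p.1) * (z + β * p.2) ≤
      max ((x + α) * (z + β)) ((x + 1) * z) := by
  have h1 : 0 < 1 - α := by linarith
  have h2 : 0 < 1 - β := by linarith
  have h3 : 0 < 1 - β - α := by linarith
  have hβ0 : 0 < β := by linarith
  suffices ∀ p ∈ Γ, ((x + α) / (1 - α) + p.1) * (z / β + p.2) ≤
      max ((x + α) / (1 - α) * (z / β + 1)) (((x + α) / (1 - α) + 1) * (z / β)) by
    intro p hp
    have := this p hp
    rw [max_right_eq (by linarith) hβ0, le_div_iff₀ (by positivity)] at this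
    refine le_trans (le_of_eq ?_) this
    field_simp
  obtain ⟨x', hx'⟩ : ∃ x', x' = (x + α) / (1 - α) := ⟨_, rfl⟩
  obtain ⟨z', hz'⟩ : ∃ z', z' = z / β := ⟨_, rfl⟩
  have ex : x = (1 - α) * x' - α := by rw [hx']; field_simp; ring
  have ez : z = β * z' := by rw [hz']; field_simp
  have hx'0 : 0 < x' := by rw [hx']; positivity
  have hz'0 : 0 ≤ z' := by rw [hz']; positivity
  rw [← hx', ← hz']
  have key : α * β * (1 - (x' - z')) + α * (1 - β) ≤ (1 - β - α) * x' := by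
    rw [ex, ez] at hM
    nlinarith
  clear hM hx hz ex ez hx' hz' x z
  -- If x' ≥ z' + 1, the product already decreases in a along a + b = 1. If x' is large enough,
  -- `le_max` applies. In the remaining case the value at (α, β) is still below that at (0, 1), and
  -- one more step makes the first coordinate large enough for `le_max`.
  by_cases hA : z' + 1 ≤ x'
  · intro p hp
    have a0 := hΓ.nonneg_left p hp
    have ab := hΓ.add_le_one p hp
    refine le_trans ?_ (le_max_left _ _)
    calc (x' + p.1) * (z' + p.2) ≤ (x' + p.1) * (z' + (1 - p.1)) := by gcongr; linarith
      _ ≤ x' * (z' + 1) := by nlinarith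
  by_cases hB : α * β ≤ (1 - β - α) * x'
  · exact hΓ.le_max hα (by linarith) hβ0 hαβ hx'0 hz'0 (Or.inl hB)
  push Not at hA hB
  have hdiff : 1 - β < β * (x' - z') := by
    have : α * (1 - β) < α * (β * (x' - z')) := by nlinarith
    exact lt_of_mul_lt_mul_left this hα.le
  have hlow : α * (1 - β) < (1 - β - α) * x' := by
    have : 0 < α * β * (1 - (x' - z')) := by
      have : 0 < 1 - (x' - z') := by linarith
      positivity
    linarith
  -- From `h0` and α < 1 - β: β(1 + β) < β(2 - α) < 1.
  have hββ : β * β < 1 - β := by nlinarith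
  have hmid : (x' + α) * (z' + β) ≤ x' * (z' + 1) := by
    have e1 : β * β < β * (x' - z') := hββ.trans hdiff
    have e2 : β < x' - z' := lt_of_mul_lt_mul_left e1 hβ0.le
    nlinarith
  have hmid' : (x' + α) * (z' + β) ≤ max (x' * (z' + 1)) ((x' + 1) * z') :=
    hmid.trans (le_max_left _ _)
  refine hΓ.step hα (by linarith) hβ0 (by linarith) hx'0.le hz'0 ?_ ?_
  · intro p hp
    refine (hΓ.le_max hα (by linarith) hβ0 hαβ (x := x' / α) (z := (z' + β) / (1 - β))
      (by positivity) (by positivity) (Or.inl ?_) p hp).trans ?_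
    · rw [← mul_div_assoc, le_div_iff₀ hα]
      nlinarith
    · rw [max_left_eq hα (by linarith)]
      exact div_le_div_of_nonneg_right (max_le (le_max_left _ _) hmid') (by positivity)
  · intro p hp
    refine (hΓ.le_max hα (by linarith) hβ0 hαβ (x := (x' + α) / (1 - α)) (z := z' / β)
      (by positivity) (by positivity) (Or.inl ?_) p hp).trans ?_
    · rw [← mul_div_assoc, le_div_iff₀ h1]
      nlinarith
    · rw [max_right_eq (by linarith) hβ0]
      exact div_le_div_of_nonneg_right (max_le hmid' (le_max_right _ _)) (by positivity)

end IsSelfSimilar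

end CrossIntersecting

namespace CrossIntersecting

open Filter Topology

/-! ### Consequences of membership in `Delta` -/

lemma lt_of_lt_e {α β : ℝ} {j : ℕ} (hα : 0 < α) (hα' : α < 1) (h : β < e j α) :
    (1 - α) * α ^ j < (1 - β) ^ (j + 1) * (1 + (1 - α) * α ^ j) := by
  have h1 : 0 < 1 - α := by linarith
  have hx : α ^ j - α ^ (j + 1) = (1 - α) * α ^ j := by ring
  have hx' : 1 + α ^ j - α ^ (j + 1) = 1 + (1 - α) * α ^ j := by ring
  rw [e, hx, hx'] at h
  set y := (1 - α) * α ^ j / (1 + (1 - α) * α ^ j) with hy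
  have hy0 : 0 ≤ y := by positivity
  have hroot : (y ^ ((1 : ℝ) / ((j : ℝ) + 1))) ^ (j + 1) = y := by
    have := Real.rpow_inv_natCast_pow hy0 (Nat.succ_ne_zero j)
    rwa [Nat.cast_succ, inv_eq_one_div] at this
  have hlt : y < (1 - β) ^ (j + 1) := by
    rw [← hroot]
    exact pow_lt_pow_left₀ (by linarith) (Real.rpow_nonneg hy0 _) (Nat.succ_ne_zero j)
  rwa [hy, div_lt_iff₀ (by positivity)] at hlt

/-- The left side is the product relative to stars at a point reached by m first-branch steps and
then one second-branch step. By `right_le_max` only the ends of that piece matter; they are the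
competitors with j = m and j = m - 1, which `Delta` excludes (for m = 0 the latter end has value 0).
-/
theorem IsSelfSimilar.mul_lt_one {α β : ℝ} {Γ : Set (ℝ × ℝ)} (hΓ : IsSelfSimilar α β Γ)
    (h : (α, β) ∈ Delta) (m : ℕ) :
    ∀ p ∈ Γ, (1 + (1 - α) / α * α ^ m * (α + (1 - α) * p.1)) *
      (1 - (1 - β) ^ m + (1 - β) ^ m * (β * p.2)) < 1 := by
  obtain ⟨⟨hα, hβ, hαβ⟩, he⟩ := h
  simp only at hα hβ hαβ he
  have hC : ∀ j, (1 - α) * α ^ j < (1 - β) ^ (j + 1) * (1 + (1 - α) * α ^ j) :=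
    fun j => lt_of_lt_e hα (by linarith) (he j)
  have h1 : 0 < 1 - α := by linarith
  have h2 : 0 < 1 - β := by linarith
  have hαm : 0 < α ^ m := by positivity
  have hqm : 0 < (1 - β) ^ m := by positivity
  have hqm1 : (1 - β) ^ m ≤ 1 := pow_le_one₀ h2.le (by linarith)
  -- Chosen so that the left side becomes (x + α + (1-α)a)(z + βb) divided by x(z + 1).
  set x := α / ((1 - α) * α ^ m) with hx
  set z := 1 / (1 - β) ^ m - 1 with hz
  have hx0 : 0 < x := by positivity
  have hz0 : 0 ≤ z := by
    rw [hz, sub_nonneg, le_div_iff₀ hqm]; linarith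
  have hM : α * (z + β) < (1 - β) * x := by
    have := hC m
    rw [hx, hz, show α * (1 / (1 - β) ^ m - 1 + β) =
      α * (1 - (1 - β) ^ (m + 1)) / (1 - β) ^ m by field_simp; ring,
      ← mul_div_assoc, div_lt_div_iff₀ hqm (by positivity)]
    have e1 : (1 - α) * α ^ m * (1 - (1 - β) ^ (m + 1)) < (1 - β) ^ (m + 1) := by linarith
    have e2 := mul_lt_mul_of_pos_left e1 hα
    rw [pow_succ] at e2 ⊢
    linarith
  have hzx : z < x := by
    rw [hx, hz, show 1 / (1 - β) ^ m - 1 = (1 - (1 - β) ^ m) / (1 - β) ^ m by field_simp,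
      div_lt_div_iff₀ hqm (by positivity)]
    rcases m with _ | j
    · simpa using hα
    · have := mul_lt_mul_of_pos_left (hC j) hα
      rw [pow_succ α j]
      linarith
  intro p hp
  have key := hΓ.right_le_max hα hβ hαβ (by have := hC 0; simp at this; linarith) hx0 hz0 hM.le p hp
  have hlt : (x + α + (1 - α) * p.1) * (z + β * p.2) < x * (z + 1) := by
    refine key.trans_lt (max_lt ?_ ?_) <;> linarith
  have e1 : 1 + (1 - α) / α * α ^ m * (α + (1 - α) * p.1) =
      (x + α + (1 - α) * p.1) / x := by
    rw [hx]; field_simp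
    ring
  have e2 : 1 - (1 - β) ^ m + (1 - β) ^ m * (β * p.2) = (z + β * p.2) / (z + 1) := by
    rw [hz]; field_simp
    ring
  rw [e1, e2, div_mul_div_comm, div_lt_one (by positivity)]
  exact hlt

/-! ### Sequences of binomial coefficients -/

section Ratio

variable {ι : Type*} {F : Filter ι} {N K L : ι → ℕ} {α β : ℝ}

/-- `N` tends to infinity and `K / N` tends to `α`. -/
structure HasRatio (F : Filter ι) (N K : ι → ℕ) (α : ℝ) : Prop where
  tendsto_atTop : Tendsto N F atTop
  tendsto_div : Tendsto (fun i => (K i : ℝ) / N i) F (𝓝 α)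

namespace HasRatio

lemma tendsto_cast (h : HasRatio F N K α) : Tendsto (fun i => (N i : ℝ)) F atTop :=
  tendsto_natCast_atTop_atTop.comp h.tendsto_atTop

lemma eventually_le (h : HasRatio F N K α) (m : ℕ) : ∀ᶠ i in F, m ≤ N i :=
  h.tendsto_atTop.eventually_ge_atTop m

lemma eventually_le_left (h : HasRatio F N K α) (hα : 0 < α) (m : ℕ) :
    ∀ᶠ i in F, m ≤ K i := by
  have := h.tendsto_div.pos_mul_atTop hα h.tendsto_cast
  filter_upwards [this.eventually_ge_atTop (m : ℝ), h.eventually_le 1] with i hi hN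
  have hN' : (N i : ℝ) ≠ 0 := by positivity
  rw [div_mul_cancel₀ _ hN'] at hi
  exact_mod_cast hi

lemma eventually_add_add_le (h : HasRatio F N K α) (h' : HasRatio F N L β) (hαβ : α + β < 1)
    (m : ℕ) : ∀ᶠ i in F, K i + L i + m ≤ N i := by
  have := ((h.tendsto_div.add h'.tendsto_div).const_sub 1).pos_mul_atTop (by linarith)
    h.tendsto_cast
  filter_upwards [this.eventually_ge_atTop (m : ℝ), h.eventually_le 1] with i hi hN
  have hN' : (N i : ℝ) ≠ 0 := by positivity
  rw [sub_mul, add_mul, div_mul_cancel₀ _ hN', div_mul_cancel₀ _ hN'] at hi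
  have : (K i + L i + m : ℝ) ≤ N i := by linarith
  exact_mod_cast this

lemma eventually_add_le (h : HasRatio F N K α) (hα : α < 1) (m : ℕ) :
    ∀ᶠ i in F, K i + m ≤ N i := by
  have h0 : HasRatio F N (fun _ => 0) 0 := ⟨h.tendsto_atTop, by simpa using tendsto_const_nhds⟩
  simpa using h.eventually_add_add_le h0 (by linarith) m

/-- Splitting lowers N by one and K by at most one, which does not affect the limiting ratio. -/
lemma of_close (h : HasRatio F N K α) {K' : ι → ℕ}
    (h1 : ∀ i, K' i ≤ K i) (h2 : ∀ i, K i ≤ K' i + 1) :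
    HasRatio F (fun i => N i - 1) K' α := by
  have hN' : Tendsto (fun i => N i - 1) F atTop := (tendsto_sub_atTop_nat 1).comp h.tendsto_atTop
  refine ⟨hN', ?_⟩
  have hcast : Tendsto (fun i => ((N i - 1 : ℕ) : ℝ)) F atTop :=
    tendsto_natCast_atTop_atTop.comp hN'
  have t1 : Tendsto (fun i => 1 + 1 / ((N i - 1 : ℕ) : ℝ)) F (𝓝 (1 + 0)) :=
    (tendsto_const_nhds.div_atTop hcast).const_add 1
  have t2 : Tendsto (fun i => ((K i - K' i : ℕ) : ℝ) / N i) F (𝓝 0) := by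
    refine squeeze_zero (fun i => by positivity) (fun i => ?_)
      (tendsto_const_nhds.div_atTop h.tendsto_cast : Tendsto (fun i => (1 : ℝ) / N i) F (𝓝 0))
    have : ((K i - K' i : ℕ) : ℝ) ≤ 1 := by exact_mod_cast (by have := h2 i; omega)
    gcongr
  have t3 := (h.tendsto_div.sub t2).mul t1
  rw [sub_zero, add_zero, mul_one] at t3
  refine t3.congr' ?_
  filter_upwards [h.eventually_le 2] with i hi
  obtain ⟨M, hM⟩ : ∃ M, N i = M + 2 := ⟨N i - 2, by omega⟩
  rw [hM, Nat.cast_sub (h1 i)]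
  have : M + 2 - 1 = M + 1 := rfl
  rw [this]
  push_cast
  have h3 : (M : ℝ) + 1 ≠ 0 := by positivity
  have h4 : (M : ℝ) + 2 ≠ 0 := by positivity
  field_simp
  ring

lemma pred (h : HasRatio F N K α) : HasRatio F (fun i => N i - 1) K α :=
  h.of_close (fun _ => le_rfl) fun _ => Nat.le_succ _

lemma pred_pred (h : HasRatio F N K α) : HasRatio F (fun i => N i - 1) (fun i => K i - 1) α :=
  h.of_close (fun _ => Nat.sub_le _ _) fun _ => by omega

lemma sub (h : HasRatio F N K α) (m : ℕ) : HasRatio F (fun i => N i - m) K α := by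
  induction m with
  | zero => exact h
  | succ m ih => exact ih.pred

lemma sub_sub (h : HasRatio F N K α) (m : ℕ) :
    HasRatio F (fun i => N i - m) (fun i => K i - m) α := by
  induction m with
  | zero => exact h
  | succ m ih => exact ih.pred_pred

lemma eventually_choose_pos (h : HasRatio F N K α) (hα : α < 1) :
    ∀ᶠ i in F, 0 < ((N i).choose (K i) : ℝ) := by
  filter_upwards [h.eventually_add_le hα 0] with i hi
  exact_mod_cast Nat.choose_pos (by omega)

lemma tendsto_choose_pred_pred (h : HasRatio F N K α) (hα : 0 < α) (hα' : α < 1) :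
    Tendsto (fun i => ((N i - 1).choose (K i - 1) : ℝ) / (N i).choose (K i)) F (𝓝 α) := by
  refine h.tendsto_div.congr' ?_
  filter_upwards [h.eventually_le 1, h.eventually_le_left hα 1, h.eventually_choose_pos hα']
    with i hN hK hpos
  obtain ⟨M, hM⟩ : ∃ M, N i = M + 1 := ⟨N i - 1, by omega⟩
  obtain ⟨J, hJ⟩ : ∃ J, K i = J + 1 := ⟨K i - 1, by omega⟩
  rw [hM, hJ] at hpos ⊢
  rw [div_eq_div_iff (by positivity) hpos.ne']
  have := Nat.add_one_mul_choose_eq M J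
  simp only [Nat.add_sub_cancel]
  exact_mod_cast (by linarith)

lemma tendsto_choose_pred (h : HasRatio F N K α) (hα' : α < 1) :
    Tendsto (fun i => ((N i - 1).choose (K i) : ℝ) / (N i).choose (K i)) F (𝓝 (1 - α)) := by
  refine (h.tendsto_div.const_sub 1).congr' ?_
  filter_upwards [h.eventually_le 1, h.eventually_add_le hα' 0, h.eventually_choose_pos hα']
    with i hN hK hpos
  obtain ⟨M, hM⟩ : ∃ M, N i = M + 1 := ⟨N i - 1, by omega⟩
  rw [hM] at hpos hK ⊢
  have h1 : ((M + 1 : ℕ) : ℝ) ≠ 0 := by positivity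
  rw [one_sub_div h1, div_eq_div_iff h1 hpos.ne', ← Nat.cast_sub (by omega)]
  have := Nat.choose_mul_succ_eq M (K i)
  simp only [Nat.add_sub_cancel]
  exact_mod_cast (by linarith)

lemma tendsto_choose_sub_sub (h : HasRatio F N K α) (hα : 0 < α) (hα' : α < 1) (m : ℕ) :
    Tendsto (fun i => ((N i - m).choose (K i - m) : ℝ) / (N i).choose (K i)) F (𝓝 (α ^ m)) := by
  induction m with
  | zero =>
    refine tendsto_const_nhds.congr' ?_
    filter_upwards [h.eventually_choose_pos hα'] with i hi
    simp [hi.ne']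
  | succ m ih =>
    have := ((h.sub_sub m).tendsto_choose_pred_pred hα hα').mul ih
    rw [pow_succ']
    refine this.congr' ?_
    filter_upwards [(h.sub_sub m).eventually_choose_pos hα'] with i hi
    rw [div_mul_div_cancel₀ hi.ne', Nat.sub_sub, Nat.sub_sub]

lemma tendsto_choose_sub (h : HasRatio F N K α) (hα' : α < 1) (m : ℕ) :
    Tendsto (fun i => ((N i - m).choose (K i) : ℝ) / (N i).choose (K i)) F
      (𝓝 ((1 - α) ^ m)) := by
  induction m with
  | zero =>
    refine tendsto_const_nhds.congr' ?_
    filter_upwards [h.eventually_choose_pos hα'] with i hi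
    simp [hi.ne']
  | succ m ih =>
    have := ((h.sub m).tendsto_choose_pred hα').mul ih
    rw [pow_succ']
    refine this.congr' ?_
    filter_upwards [(h.sub m).eventually_choose_pos hα'] with i hi
    rw [div_mul_div_cancel₀ hi.ne', Nat.sub_sub]

lemma tendsto_choose_div_choose_pred (h : HasRatio F N K α) (hα : 0 < α) (hα' : α < 1) :
    Tendsto (fun i => ((N i).choose (K i) : ℝ) / (N i).choose (K i - 1)) F
      (𝓝 ((1 - α) / α)) := by
  have t : Tendsto (fun i => (1 : ℝ) / N i) F (𝓝 0) :=
    tendsto_const_nhds.div_atTop h.tendsto_cast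
  have := ((h.tendsto_div.const_sub 1).add t).div h.tendsto_div hα.ne'
  rw [add_zero] at this
  refine this.congr' ?_
  filter_upwards [h.eventually_le 1, h.eventually_le_left hα 1, h.eventually_add_le hα' 0]
    with i hN hK hKN
  obtain ⟨J, hJ⟩ : ∃ J, K i = J + 1 := ⟨K i - 1, by omega⟩
  have hN' : (0 : ℝ) < N i := by exact_mod_cast hN
  have h1 := Nat.choose_succ_right_eq (N i) J
  have hpos : (0 : ℝ) < (N i).choose J := by exact_mod_cast Nat.choose_pos (by omega)
  simp only [Pi.div_apply]
  rw [hJ, Nat.add_sub_cancel]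
  have h2 : ((N i).choose (J + 1) : ℝ) * (J + 1) = (N i).choose J * (N i - J) := by
    rw [← Nat.cast_sub (by omega)]
    exact_mod_cast h1
  push_cast
  have hJ' : (0 : ℝ) < J + 1 := by positivity
  field_simp
  linarith

end HasRatio

end Ratio

end CrossIntersecting

namespace CrossIntersecting

open Filter Topology

/-! ### Limits of feasible densities -/

lemma exists_tendsto_div {ι : Type*} (U : Ultrafilter ι) {f g : ι → ℕ}
    (h : ∀ᶠ i in (U : Filter ι), f i ≤ g i) :
    ∃ a : ℝ, Tendsto (fun i => (f i : ℝ) / g i) U (𝓝 a) := by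
  have hmem : ∀ᶠ i in (U : Filter ι), (f i : ℝ) / g i ∈ Set.Icc (0 : ℝ) 1 := by
    filter_upwards [h] with i hi
    exact ⟨by positivity, div_le_one_of_le₀ (by exact_mod_cast hi) (by positivity)⟩
  obtain ⟨a, -, ha⟩ := isCompact_Icc.ultrafilter_le_nhds (U.map fun i => (f i : ℝ) / g i)
    (le_principal_iff.2 hmem)
  exact ⟨a, ha⟩

/-- The limits along `U` of pairs of densities of cross-intersecting families of `K`-sets and
`L`-sets of an `N`-set, where `N` tends to infinity and `K / N`, `L / N` tend to `α`, `β`. -/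
def limitSet {ι : Type*} (U : Ultrafilter ι) (α β : ℝ) : Set (ℝ × ℝ) :=
  {p | ∃ N K L u v : ι → ℕ, HasRatio U N K α ∧ HasRatio U N L β ∧
    (∀ᶠ i in (U : Filter ι), Feasible (N i) (K i) (L i) (u i) (v i)) ∧
    Tendsto (fun i => (u i : ℝ) / (N i).choose (K i)) U (𝓝 p.1) ∧
    Tendsto (fun i => (v i : ℝ) / (N i).choose (L i)) U (𝓝 p.2)}

section LimitSet

variable {ι : Type*} {U : Ultrafilter ι} {α β : ℝ}

lemma swap_mem_limitSet {p : ℝ × ℝ} (hp : p ∈ limitSet U α β) : p.swap ∈ limitSet U β α := by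
  obtain ⟨N, K, L, u, v, hK, hL, hF, hu, hv⟩ := hp
  exact ⟨N, L, K, v, u, hL, hK, hF.mono fun i h => h.symm, hv, hu⟩

lemma exists_mem_limitSet {N K L u v : ι → ℕ} (hK : HasRatio U N K α) (hL : HasRatio U N L β)
    (hF : ∀ᶠ i in (U : Filter ι), Feasible (N i) (K i) (L i) (u i) (v i)) :
    ∃ p ∈ limitSet U α β, Tendsto (fun i => (u i : ℝ) / (N i).choose (K i)) U (𝓝 p.1) ∧
      Tendsto (fun i => (v i : ℝ) / (N i).choose (L i)) U (𝓝 p.2) := by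
  obtain ⟨a, ha⟩ := exists_tendsto_div U (hF.mono fun i h => h.left_le)
  obtain ⟨b, hb⟩ := exists_tendsto_div U (hF.mono fun i h => h.right_le)
  exact ⟨(a, b), ⟨N, K, L, u, v, hK, hL, hF, ha, hb⟩, ha, hb⟩

lemma exists_mem_limitSet_of_feasible_pred (hα : 0 < α) (hα' : α < 1) (hβ : 0 < β) (hβ' : β < 1)
    {N K L u v : ι → ℕ} {p : ℝ × ℝ} (hK : HasRatio U N K α) (hL : HasRatio U N L β)
    (hu : Tendsto (fun i => (u i : ℝ) / (N i).choose (K i)) U (𝓝 p.1))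
    (hv : Tendsto (fun i => (v i : ℝ) / (N i).choose (L i)) U (𝓝 p.2))
    (hF : ∀ᶠ i in (U : Filter ι), Feasible (N i - 1) (K i - 1) (L i) (u i)
      (v i - (N i - 1).choose (L i - 1))) :
    ∃ p' ∈ limitSet U α β, p.1 ≤ α * p'.1 ∧ p.2 ≤ β + (1 - β) * p'.2 := by
  obtain ⟨p', hp', ta, tb⟩ := exists_mem_limitSet hK.pred_pred hL.pred hF
  refine ⟨p', hp', ?_, ?_⟩
  · refine le_of_eq (tendsto_nhds_unique hu ?_)
    refine ((hK.tendsto_choose_pred_pred hα hα').mul ta).congr' ?_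
    filter_upwards [hK.pred_pred.eventually_choose_pos hα'] with i hi
    rw [mul_comm, div_mul_div_cancel₀ hi.ne']
  · refine le_of_tendsto_of_tendsto hv
      ((hL.tendsto_choose_pred_pred hβ hβ').add ((hL.tendsto_choose_pred hβ').mul tb)) ?_
    filter_upwards [hL.pred.eventually_choose_pos hβ'] with i hi
    rw [mul_comm (_ / _) (_ / _), div_mul_div_cancel₀ hi.ne', ← add_div]
    gcongr
    exact_mod_cast (by omega)

/-- An ultrafilter decides which branch of the split occurs, and compactness supplies the limits for
the smaller pair. The chord bound passes to the limit as a + b ≤ 1. -/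
theorem isSelfSimilar_limitSet (hα : 0 < α) (hβ : 0 < β) (hαβ : α + β < 1) :
    IsSelfSimilar α β (limitSet U α β) where
  nonneg_left := by
    rintro p ⟨N, K, L, u, v, hK, hL, hF, hu, hv⟩
    exact ge_of_tendsto' hu fun i => by positivity
  nonneg_right := by
    rintro p ⟨N, K, L, u, v, hK, hL, hF, hu, hv⟩
    exact ge_of_tendsto' hv fun i => by positivity
  add_le_one := by
    rintro p ⟨N, K, L, u, v, hK, hL, hF, hu, hv⟩
    refine le_of_tendsto (hu.add hv) ?_
    filter_upwards [hF, hK.eventually_add_add_le hL hαβ 0,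
      hK.eventually_choose_pos (by linarith), hL.eventually_choose_pos (by linarith)]
      with i hFi hle hKpos hLpos
    have := hFi.chord (by omega)
    rw [div_add_div _ _ hKpos.ne' hLpos.ne', div_le_one (by positivity)]
    exact_mod_cast (by linarith)
  cover := by
    rintro p ⟨N, K, L, u, v, hK, hL, hF, hu, hv⟩
    have hsplit : ∀ᶠ i in (U : Filter ι),
        Feasible (N i - 1) (K i - 1) (L i) (u i) (v i - (N i - 1).choose (L i - 1)) ∨
        Feasible (N i - 1) (K i) (L i - 1) (u i - (N i - 1).choose (K i - 1)) (v i) := by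
      filter_upwards [hF, hK.eventually_add_add_le hL hαβ 0, hK.eventually_le_left hα 1,
        hL.eventually_le_left hβ 1] with i hFi hle hK1 hL1
      obtain ⟨n, hn⟩ : ∃ n, N i = n + 1 := ⟨N i - 1, by omega⟩
      obtain ⟨k, hk⟩ : ∃ k, K i = k + 1 := ⟨K i - 1, by omega⟩
      obtain ⟨l, hl⟩ : ∃ l, L i = l + 1 := ⟨L i - 1, by omega⟩
      rw [hn, hk, hl] at hFi ⊢
      exact hFi.split (by omega)
    rcases Ultrafilter.eventually_or.1 hsplit with h | h
    · obtain ⟨p', hp', h1⟩ := exists_mem_limitSet_of_feasible_pred hα (by linarith) hβ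
        (by linarith) hK hL hu hv h
      exact ⟨p', hp', Or.inl h1⟩
    · obtain ⟨p', hp', h1⟩ := exists_mem_limitSet_of_feasible_pred (p := p.swap) hβ (by linarith)
        hα (by linarith) hL hK hv hu (h.mono fun i h => h.symm)
      exact ⟨p'.swap, swap_mem_limitSet hp', Or.inr ⟨h1.2, h1.1⟩⟩

end LimitSet

/-! ### First families larger than a star -/

section Asymptotic

variable {ι : Type*} {U : Ultrafilter ι} {α β : ℝ} {N K L u v : ι → ℕ}

/-- Here u is the excess of the first family over a star, on the ground set without the centre. The
second branch after m first-branch steps would, in the limit, give a product of at least 1 where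
`mul_lt_one` gives less. -/
lemma not_eventually_feasible_branch (hΔ : (α, β) ∈ Delta) (hK : HasRatio U N K α)
    (hL : HasRatio U N L β)
    (hprod : ∀ᶠ i in (U : Filter ι), (N i).choose (K i - 1) * (N i).choose (L i) ≤
      ((N i).choose (K i - 1) + u i) * v i) (m : ℕ) :
    ¬ ∀ᶠ i in (U : Filter ι), Feasible (N i - m - 1) (K i - m) (L i - 1)
      (u i - (N i - m - 1).choose (K i - m - 1))
      (v i + (N i - m).choose (L i) - (N i).choose (L i)) := by
  intro hF
  obtain ⟨hα, hβ, hαβ⟩ := hΔ.1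
  simp only at hα hβ hαβ
  have hKm := hK.sub_sub m
  have hLm := hL.sub m
  obtain ⟨p, hp, ta, tb⟩ := exists_mem_limitSet hKm.pred hLm.pred_pred hF
  have hlt := (isSelfSimilar_limitSet hα (by linarith) hαβ).mul_lt_one hΔ m p hp
  refine absurd hlt (not_lt.2 ?_)
  have tX := (hK.tendsto_choose_div_choose_pred hα (by linarith)).mul
    (hK.tendsto_choose_sub_sub hα (by linarith) m)
  have t1 := ((tX.mul ((hKm.tendsto_choose_pred_pred hα (by linarith)).add
    ((hKm.tendsto_choose_pred (by linarith)).mul ta))).const_add 1)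
  have tY := hL.tendsto_choose_sub (by linarith) m
  have t2 := (tY.const_sub 1).add
    (tY.mul ((hLm.tendsto_choose_pred_pred (by linarith) (by linarith)).mul tb))
  refine ge_of_tendsto (t1.mul t2) ?_
  filter_upwards [hprod, hK.eventually_choose_pos (by linarith),
    hL.eventually_choose_pos (by linarith), hKm.eventually_choose_pos (by linarith),
    hLm.eventually_choose_pos (by linarith), hKm.pred.eventually_choose_pos (by linarith),
    hLm.pred_pred.eventually_choose_pos (by linarith), hK.eventually_add_le (by linarith) 0]
    with i hi p1 p2 p3 p4 p5 p6 hKN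
  have p0 : (0 : ℝ) < (N i).choose (K i - 1) := by
    exact_mod_cast Nat.choose_pos (by omega)
  have e1 : ((N i).choose (K i) : ℝ) / (N i).choose (K i - 1) *
      ((N i - m).choose (K i - m) / (N i).choose (K i)) *
      ((N i - m - 1).choose (K i - m - 1) / (N i - m).choose (K i - m) +
        (N i - m - 1).choose (K i - m) / (N i - m).choose (K i - m) *
        (((u i - (N i - m - 1).choose (K i - m - 1) : ℕ) : ℝ) /
          (N i - m - 1).choose (K i - m))) =
      ((N i - m - 1).choose (K i - m - 1) +
        ((u i - (N i - m - 1).choose (K i - m - 1) : ℕ) : ℝ)) / (N i).choose (K i - 1) := by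
    field_simp
  have e2 : 1 - ((N i - m).choose (L i) : ℝ) / (N i).choose (L i) +
      (N i - m).choose (L i) / (N i).choose (L i) *
      ((N i - m - 1).choose (L i - 1) / (N i - m).choose (L i) *
        (((v i + (N i - m).choose (L i) - (N i).choose (L i) : ℕ) : ℝ) /
          (N i - m - 1).choose (L i - 1))) =
      ((N i).choose (L i) - (N i - m).choose (L i) +
        ((v i + (N i - m).choose (L i) - (N i).choose (L i) : ℕ) : ℝ)) / (N i).choose (L i) := by
    field_simp
  rw [e1, e2, one_add_div p0.ne', div_mul_div_comm, one_le_div (by positivity)]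
  have b1 : (u i : ℝ) ≤ (N i - m - 1).choose (K i - m - 1) +
      ((u i - (N i - m - 1).choose (K i - m - 1) : ℕ) : ℝ) := by
    exact_mod_cast (by omega)
  have b2 : (v i : ℝ) ≤ (N i).choose (L i) - (N i - m).choose (L i) +
      ((v i + (N i - m).choose (L i) - (N i).choose (L i) : ℕ) : ℝ) := by
    have : v i + (N i - m).choose (L i) ≤ (N i).choose (L i) +
      (v i + (N i - m).choose (L i) - (N i).choose (L i)) := by omega
    have : (v i : ℝ) + (N i - m).choose (L i) ≤ (N i).choose (L i) +
      ((v i + (N i - m).choose (L i) - (N i).choose (L i) : ℕ) : ℝ) := by exact_mod_cast this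
    linarith
  calc ((N i).choose (K i - 1) : ℝ) * (N i).choose (L i)
      ≤ ((N i).choose (K i - 1) + u i) * v i := by exact_mod_cast hi
    _ ≤ _ := by gcongr

lemma eventually_feasible_sub (hΔ : (α, β) ∈ Delta) (hK : HasRatio U N K α)
    (hL : HasRatio U N L β)
    (hF : ∀ᶠ i in (U : Filter ι), Feasible (N i) (K i) (L i) (u i) (v i))
    (hprod : ∀ᶠ i in (U : Filter ι), (N i).choose (K i - 1) * (N i).choose (L i) ≤
      ((N i).choose (K i - 1) + u i) * v i) (m : ℕ) :
    ∀ᶠ i in (U : Filter ι), Feasible (N i - m) (K i - m) (L i) (u i)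
      (v i + (N i - m).choose (L i) - (N i).choose (L i)) := by
  obtain ⟨hα, hβ, hαβ⟩ := hΔ.1
  simp only at hα hβ hαβ
  induction m with
  | zero => simpa using hF
  | succ m ih =>
    have hsplit : ∀ᶠ i in (U : Filter ι),
        Feasible (N i - (m + 1)) (K i - (m + 1)) (L i) (u i)
          (v i + (N i - (m + 1)).choose (L i) - (N i).choose (L i)) ∨
        Feasible (N i - m - 1) (K i - m) (L i - 1) (u i - (N i - m - 1).choose (K i - m - 1))
          (v i + (N i - m).choose (L i) - (N i).choose (L i)) := by
      filter_upwards [ih, hK.eventually_add_add_le hL hαβ 0, hK.eventually_le_left hα (m + 1),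
        hL.eventually_le_left (by linarith) 1] with i hFi hle hK1 hL1
      obtain ⟨n, hn⟩ : ∃ n, N i - m = n + 1 := ⟨N i - m - 1, by omega⟩
      obtain ⟨k, hk⟩ : ∃ k, K i - m = k + 1 := ⟨K i - m - 1, by omega⟩
      obtain ⟨l, hl⟩ : ∃ l, L i = l + 1 := ⟨L i - 1, by omega⟩
      rw [← Nat.sub_sub, ← Nat.sub_sub]
      rw [hn, hk, hl] at hFi ⊢
      have hpascal := Nat.choose_succ_succ' n l
      rcases hFi.split (by omega) with h | h
      · refine Or.inl ?_
        have hv : v i + (n + 1).choose (l + 1) - (N i).choose (l + 1) - n.choose l =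
            v i + n.choose (l + 1) - (N i).choose (l + 1) := by omega
        rwa [hv] at h
      · exact Or.inr h
    rcases Ultrafilter.eventually_or.1 hsplit with h | h
    · exact h
    · exact absurd h (not_eventually_feasible_branch hΔ hK hL hprod m)

theorem not_eventually_choose_mul_choose_le (hΔ : (α, β) ∈ Delta) (hK : HasRatio U N K α)
    (hL : HasRatio U N L β)
    (hF : ∀ᶠ i in (U : Filter ι), Feasible (N i) (K i) (L i) (u i) (v i))
    (hu : ∀ᶠ i in (U : Filter ι), 0 < u i) :
    ¬ ∀ᶠ i in (U : Filter ι), (N i).choose (K i - 1) * (N i).choose (L i) ≤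
      ((N i).choose (K i - 1) + u i) * v i := by
  intro hprod
  obtain ⟨hα, hβ, hαβ⟩ := hΔ.1
  simp only at hα hβ hαβ
  have h1 : 0 < 1 - α := by linarith
  have h2 : 0 < 1 - β := by linarith
  -- Possible because α < 1 - β.
  obtain ⟨m, hm⟩ : ∃ m : ℕ, (1 - α) / α * α ^ m < (1 - β) ^ m := by
    obtain ⟨m, hm⟩ := exists_pow_lt_of_lt_one (x := α / (1 - α)) (y := α / (1 - β))
      (by positivity) ((div_lt_one h2).2 (by linarith))
    refine ⟨m, ?_⟩
    rw [div_pow, div_lt_div_iff₀ (by positivity) h1] at hm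
    rw [div_mul_eq_mul_div, div_lt_iff₀ hα]
    linarith
  have tX := (hK.tendsto_choose_div_choose_pred hα (by linarith)).mul
    (hK.tendsto_choose_sub_sub hα (by linarith) m)
  have hXY := tX.eventually_lt (hL.tendsto_choose_sub (by linarith) m) hm
  obtain ⟨i, hXYi, hFm, hFi, hui, hi, p1, p2, p3, p4, hle⟩ := (hXY.and
    ((eventually_feasible_sub hΔ hK hL hF hprod m).and (hF.and (hu.and (hprod.and
    ((hK.eventually_choose_pos (by linarith)).and ((hL.eventually_choose_pos (by linarith)).and
    (((hK.sub_sub m).eventually_choose_pos (by linarith)).and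
    (((hL.sub m).eventually_choose_pos (by linarith)).and
    ((hK.sub_sub m).eventually_add_add_le (hL.sub m) hαβ 0)))))))))).exists
  have hchord := hFm.chord (by omega)
  have hv := hFi.right_le
  have p0 : (0 : ℝ) < (N i).choose (K i - 1) := by
    have := Nat.pos_of_ne_zero (n := (N i).choose (K i)) (by rintro h; simp [h] at p1)
    exact_mod_cast Nat.choose_pos (by
      by_contra hcon
      rw [Nat.choose_eq_zero_of_lt (by omega)] at this
      omega)
  rw [div_mul_div_comm, mul_comm ((N i).choose (K i) : ℝ), mul_div_mul_right _ _ p1.ne',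
    div_lt_div_iff₀ p0 p2] at hXYi
  have hch : (u i : ℝ) * (N i - m).choose (L i) ≤
      (N i - m).choose (K i - m) * ((N i).choose (L i) - v i) := by
    have c1 : v i + (N i - m).choose (L i) ≤ (N i).choose (L i) +
      (v i + (N i - m).choose (L i) - (N i).choose (L i)) := by omega
    have c2 : (v i : ℝ) + (N i - m).choose (L i) ≤ (N i).choose (L i) +
      ((v i + (N i - m).choose (L i) - (N i).choose (L i) : ℕ) : ℝ) := by exact_mod_cast c1
    have c3 : (u i : ℝ) * (N i - m).choose (L i) +
      ((v i + (N i - m).choose (L i) - (N i).choose (L i) : ℕ) : ℝ) *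
        (N i - m).choose (K i - m) ≤
      (N i - m).choose (K i - m) * (N i - m).choose (L i) := by exact_mod_cast hchord
    nlinarith
  have hi' : ((N i).choose (K i - 1) : ℝ) * (N i).choose (L i) ≤
    ((N i).choose (K i - 1) + u i) * v i := by exact_mod_cast hi
  have hu' : (0 : ℝ) < u i := by exact_mod_cast hui
  have hv' : (v i : ℝ) ≤ (N i).choose (L i) := by exact_mod_cast hv
  have hv0 : (0 : ℝ) ≤ v i := by positivity
  generalize ((N i).choose (K i - 1) : ℝ) = S at *
  generalize ((N i).choose (L i) : ℝ) = T at *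
  generalize ((N i - m).choose (K i - m) : ℝ) = X at *
  generalize ((N i - m).choose (L i) : ℝ) = Y at *
  generalize (u i : ℝ) = a at *
  generalize (v i : ℝ) = b at *
  -- A positive excess a forces this, since aY ≤ X(T - b). Then YS(T - b) ≤ Yab ≤ X(T - b)T,
  -- contrary to XT < YS.
  have hTb : 0 < T - b := by
    by_contra hcon
    have : 0 < a * Y := by positivity
    nlinarith
  have s1 : S * (T - b) ≤ a * b := by linarith
  have s2 : Y * (S * (T - b)) ≤ Y * (a * b) := by gcongr
  have s3 : a * Y * b ≤ X * (T - b) * T := by gcongr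
  have s4 : X * T * (T - b) < Y * S * (T - b) := by gcongr
  linarith

end Asymptotic

end CrossIntersecting

namespace CrossIntersecting

open Filter Topology

/-! ### From limits to all large n -/

lemma hasRatio_floor {α : ℝ} (hα : 0 ≤ α) :
    HasRatio atTop (fun n : ℕ => n) (fun n => ⌊α * (n : ℝ)⌋₊) α :=
  ⟨tendsto_id, (tendsto_nat_floor_mul_div_atTop hα).comp tendsto_natCast_atTop_atTop⟩

lemma HasRatio.mono {ι : Type*} {F G : Filter ι} {N K : ι → ℕ} {α : ℝ} (h : HasRatio F N K α)
    (hGF : G ≤ F) : HasRatio G N K α :=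
  ⟨h.tendsto_atTop.mono_left hGF, h.tendsto_div.mono_left hGF⟩

/-- Counterexamples for arbitrarily large n would carry an ultrafilter finer than `atTop`, along
which the asymptotic results apply to the excess over a star. -/
theorem eventually_mul_lt_of_left_gt {α β : ℝ} (hΔ : (α, β) ∈ Delta) :
    ∀ᶠ n : ℕ in atTop, ∀ u v : ℕ, Feasible n ⌊α * (n : ℝ)⌋₊ ⌊β * (n : ℝ)⌋₊ u v →
      (n - 1).choose (⌊α * (n : ℝ)⌋₊ - 1) < u →
      u * v < (n - 1).choose (⌊α * (n : ℝ)⌋₊ - 1) * (n - 1).choose (⌊β * (n : ℝ)⌋₊ - 1) := by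
  obtain ⟨hα, hβ, hαβ⟩ := hΔ.1
  simp only at hα hβ hαβ
  by_contra hcon
  rw [not_eventually, frequently_iff_neBot] at hcon
  obtain ⟨U, hle⟩ := @Ultrafilter.exists_le _ _ hcon
  have hUat : (U : Filter ℕ) ≤ atTop := hle.trans inf_le_left
  have hbad := le_principal_iff.1 (hle.trans inf_le_right)
  have hbad' : ∀ᶠ n : ℕ in (U : Filter ℕ), ∃ u v : ℕ,
      Feasible n ⌊α * (n : ℝ)⌋₊ ⌊β * (n : ℝ)⌋₊ u v ∧
      (n - 1).choose (⌊α * (n : ℝ)⌋₊ - 1) < u ∧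
      (n - 1).choose (⌊α * (n : ℝ)⌋₊ - 1) * (n - 1).choose (⌊β * (n : ℝ)⌋₊ - 1) ≤ u * v := by
    filter_upwards [hbad] with n hn
    simpa only [Set.mem_ofPred_eq, not_forall, not_lt, exists_prop] using hn
  have hK := (hasRatio_floor hα.le).mono hUat
  have hL := (hasRatio_floor (α := β) (by linarith)).mono hUat
  obtain ⟨u, hu⟩ := hbad'.choice
  obtain ⟨v, hv⟩ := hu.choice
  refine not_eventually_choose_mul_choose_le (U := U) hΔ hK.pred hL.pred_pred
    (u := fun n => u n - (n - 1).choose (⌊α * (n : ℝ)⌋₊ - 1)) (v := v) ?_ ?_ ?_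
  · filter_upwards [hv, hK.eventually_add_add_le hL hαβ 0, hK.eventually_le_left hα 1,
      hL.eventually_le_left (by linarith) 1] with n hn hle hk hl
    obtain ⟨hF, hlt, -⟩ := hn
    generalize ⌊α * (n : ℝ)⌋₊ = k at *
    generalize ⌊β * (n : ℝ)⌋₊ = l at *
    obtain ⟨n, rfl⟩ : ∃ n', n = n' + 1 := ⟨n - 1, by omega⟩
    obtain ⟨k, rfl⟩ : ∃ k', k = k' + 1 := ⟨k - 1, by omega⟩
    obtain ⟨l, rfl⟩ : ∃ l', l = l' + 1 := ⟨l - 1, by omega⟩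
    simp only [Nat.add_sub_cancel] at hlt ⊢
    -- The first branch would make u at most the size of a star.
    rcases hF.split (by omega) with h | h
    · exact absurd h.left_le (not_le.2 hlt)
    · exact h
  · filter_upwards [hv] with n hn
    have := hn.2.1
    omega
  · filter_upwards [hv] with n hn
    rw [Nat.add_sub_cancel' hn.2.1.le]
    exact hn.2.2

end CrossIntersecting

open CrossIntersecting Filter

/-! ### The main theorem -/

theorem theorem2 (α β : ℝ) (h : (α, β) ∈ CrossIntersecting.Delta) :
    ∃ n₀ : ℕ, ∀ n : ℕ, n₀ < n → ∀ k l : ℕ, k = ⌊α * (n : ℝ)⌋₊ → l = ⌊β * (n : ℝ)⌋₊ →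
      IsGreatest (CrossIntersecting.crossProducts n k l)
        ((n - 1).choose (k - 1) * (n - 1).choose (l - 1)) ∧
      ∀ A B : Finset (Finset (Fin n)), CrossIntersecting.IsCrossPair n k l A B →
        A.card * B.card = (n - 1).choose (k - 1) * (n - 1).choose (l - 1) →
        ∃ i : Fin n, A = CrossIntersecting.star n k i ∧ B = CrossIntersecting.star n l i := by
  obtain ⟨hα, hβ, hαβ⟩ := h.1
  simp only at hα hβ hαβ
  have hK := hasRatio_floor hα.le
  have hL := hasRatio_floor (α := β) (by linarith)
  have hhalf : ∀ᶠ n : ℕ in atTop, n < 2 * ⌊β * (n : ℝ)⌋₊ := by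
    filter_upwards [hL.tendsto_div.eventually (lt_mem_nhds hβ), eventually_ge_atTop 1] with n hn h1
    rw [div_lt_div_iff₀ (by norm_num) (by exact_mod_cast h1)] at hn
    exact_mod_cast (by linarith : (n : ℝ) < 2 * (⌊β * (n : ℝ)⌋₊ : ℝ))
  obtain ⟨n₀, hn₀⟩ := eventually_atTop.1 ((eventually_mul_lt_of_left_gt h).and
    (hhalf.and ((hK.eventually_add_add_le hL hαβ 1).and ((hK.eventually_le_left hα 2).and
    (hL.eventually_le_left (by linarith) 2)))))
  refine ⟨n₀, fun n hn k l hk hl => ?_⟩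
  obtain ⟨hlt, hhalf, hkl, hk2, hl2⟩ := hn₀ n hn.le
  rw [← hk, ← hl] at hlt
  rw [← hl] at hhalf hl2 hkl
  rw [← hk] at hk2 hkl
  clear hk hl hn
  obtain ⟨n, rfl⟩ : ∃ n', n = n' + 2 := ⟨n - 2, by omega⟩
  obtain ⟨k, rfl⟩ : ∃ k', k = k' + 2 := ⟨k - 2, by omega⟩
  obtain ⟨l, rfl⟩ : ∃ l', l = l' + 2 := ⟨l - 2, by omega⟩
  simp only [Nat.add_succ_sub_one] at hlt ⊢
  have hmax : ∀ u v, Feasible (n + 2) (k + 2) (l + 2) u v →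
      u * v ≤ (n + 1).choose (k + 1) * (n + 1).choose (l + 1) ∧
      (u * v = (n + 1).choose (k + 1) * (n + 1).choose (l + 1) →
        u = (n + 1).choose (k + 1) ∧ v = (n + 1).choose (l + 1)) := by
    intro u v hF
    rcases le_or_gt u ((n + 1).choose (k + 1)) with hu | hu
    · exact hF.mul_le_of_left_le (by omega) (by omega) hu
    · have := hlt u v hF hu
      exact ⟨this.le, fun heq => absurd heq this.ne⟩
  refine ⟨⟨⟨_, _, isCrossPair_star (n + 2) (k + 2) (l + 2) 0, ?_⟩, ?_⟩, ?_⟩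
  · rw [card_star, card_star]
  · rintro _ ⟨A, B, hAB, rfl⟩
    exact (hmax _ _ hAB.feasible).1
  · intro A B hAB hcard
    obtain ⟨hA, hB⟩ := (hmax _ _ hAB.feasible).2 hcard
    exact hAB.eq_star (by omega) hA hB
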